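/- \textbf{Setting.} Let $P$ be a finite poset, $E(P)$ its set of covering relations $p\lessdot q$, and $\varepsilon\colon E(P)\to\{1,-1\}$ an edge labeling. Let $\mathrm{Aut}(P,\varepsilon)$ be the group of automorphisms $\psi$ of $P$ with $\varepsilon(\psi(p)\lessdot\psi(q))=\varepsilon(p\lessdot q)$ for all $p\lessdot q$. The poset $P$ is called \emph{$\varepsilon$-consistent} if, for every $y\in P$, the sum of the labels along a maximal saturated chain of $P_{\le y}=\{x\in P\mid x\le y\}$ is the same for all such chains; this common sum is the rank $\rho_P(y)\in\mathbb Z$. A \emph{saturation} of an $\varepsilon$-consistent poset $(P,\varepsilon)$ is a pair $(Q,\delta)$ where $Q$ is a $\delta$-consistent poset with the same underlying set as $P$ such that: $x<_Py$ implies $x<_Qy$; $\rho_Q(x)=\rho_P(x)$ for all $x$; and any $x,y$ with $|\rho_Q(x)-\rho_Q(y)|=1$ are comparable in $Q$. A permutation $g$ acts on such pairs by $x<_{gQ}y\Leftrightarrow g^{-1}x<_Qg^{-1}y$ and $(g\delta)(x\lessdot y)=\delta(g^{-1}x\lessdot g^{-1}y)$; elements of $\mathrm{Aut}(P,\varepsilon)$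 permute the saturations of $(P,\varepsilon)$, and for a subgroup $G$ of $\mathrm{Aut}(P,\varepsilon)$ one has $\mathrm{stab}_G(Q,\delta)=G\cap\mathrm{Aut}(Q,\delta)$. Let $\mathscr O(P,\varepsilon)$ be the set of functions $f\colon P\to[0,1]$ such that $f(p)\ge f(q)$ if $p\le_P q$, and $f(p)>f(q)$ if $p<_Pq$ and some saturated chain from $p$ to $q$ has an edge labeled $-1$. Put $m\mathscr O(P,\varepsilon)=\{mf\mid f\in\mathscr O(P,\varepsilon)\}$ for $m\geq 1$, and let $0\mathscr O(P,\varepsilon)$ be $\{0\}$ if all labels are $1$ and $\emptyset$ otherwise. For a finite group $G$ let $\mathrm R_G$ be its ring of complex virtual characters. For $G\le\mathrm{Aut}(P,\varepsilon)$, let $\chi_{m\mathscr O(P,\varepsilon)}\in \mathrm R_G$ be the character of the permutation action $f\mapsto f\circ g^{-1}$ of $G$ on $m\mathscr O(P,\varepsilon)\cap\mathbb Z^P$, let $\widetilde\eta_G$ be the representation of $G$ on $\mathbb C^P\oplus\mathbb C$ given by $(f,c)\mapsto (f\circ g^{-1},c)$, and define in $\mathrm R_G[[t]]$ the equivariant $h^*$-series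 $${\mathfrak h^*}^G_{P,\varepsilon}(t)=\Big(\sum_{m\ge0}\chi_{m\mathscr O(P,\varepsilon)}t^m\Big)\cdot\det(\mathrm{Id}-\widetilde\eta_Gt),\qquad \det(\mathrm{Id}-\widetilde\eta_Gt)=\sum_{i=0}^{|P|+1}(-1)^i\chi_{\wedge^i\widetilde\eta_G}t^i .$$ \textbf{Theorem.} Let $P$ be an $\varepsilon$-consistent poset, let $G$ be a subgroup of $\mathrm{Aut}(P,\varepsilon)$, and let $(Q_1,\delta_1),\dots,(Q_k,\delta_k)$ be representatives of the $G$-orbits of the set of all saturations of $(P,\varepsilon)$. Then, in $\mathrm R_G[[t]]$, $${\mathfrak h^*}^G_{P,\varepsilon}(t)=\sum_{i=1}^k\mathrm{Ind}^G_{\mathrm{stab}_G(Q_i,\delta_i)}\mathrm{Res}^{\mathrm{Aut}(Q_i,\delta_i)}_{\mathrm{stab}_G(Q_i,\delta_i)}{\mathfrak h^*}^{\mathrm{Aut}(Q_i,\delta_i)}_{Q_i,\delta_i}(t),$$ where induction and restriction of virtual characters are applied coefficientwise. -/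

import Mathlib

/-! ### Virtual characters of a finite group -/

section VirtualCharacters

/-- The set of characters of the finite-dimensional complex representations of `G`. -/
def complexCharacters (G : Type*) [Group G] : Set (G → ℂ) :=
  {χ | ∃ (n : ℕ) (ρ : Representation ℂ G (Fin n → ℂ)), χ = ρ.character}

/-- The ring `R_G` of virtual characters of `G`: the subring of the ring of complex functions on
`G` generated by the characters. -/
def VirtualCharacterRing (G : Type*) [Group G] : Subring (G → ℂ) :=
  Subring.closure (complexCharacters G)

theorem character_mem_complexCharacters {G A : Type*} [Group G] [AddCommGroup A] [Module ℂ A]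
    [Module.Finite ℂ A] (ρ : Representation ℂ G A) : ρ.character ∈ complexCharacters G := by
  let b := (Module.finBasis ℂ A).equivFun
  refine ⟨Module.finrank ℂ A,
    { toFun := fun g => b.conj (ρ g)
      map_one' := by ext; simp [LinearEquiv.conj_apply]
      map_mul' := fun g h => by
        rw [map_mul]
        exact LinearEquiv.conj_comp b (ρ h) (ρ g) }, ?_⟩
  funext g
  exact (LinearMap.trace_conj' (ρ g) b).symm

/-- The class in `R_G` of a finite-dimensional complex representation. -/
noncomputable def virtualCharacter {G A : Type*} [Group G] [AddCommGroup A] [Module ℂ A]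
    [Module.Finite ℂ A] (ρ : Representation ℂ G A) : VirtualCharacterRing G :=
  ⟨ρ.character, Subring.subset_closure (character_mem_complexCharacters ρ)⟩

/-- Restriction of virtual characters along a group homomorphism `φ : H → G` (in particular along
an inclusion of groups): the class of `ρ` goes to the class of `ρ ∘ φ`. -/
noncomputable def resVirtual {G H : Type*} [Group G] [Group H] (φ : H →* G) :
    VirtualCharacterRing G →+* VirtualCharacterRing H where
  toFun χ := ⟨fun h => χ.1 (φ h), by
    obtain ⟨χ, hχ⟩ := χ
    change (RingHom.pi (fun h => Pi.evalRingHom (fun _ : G => ℂ) (φ h))) χ ∈ _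
    rw [← Subring.mem_comap]
    refine (Subring.closure_le.2 ?_ : VirtualCharacterRing G ≤ _) hχ
    rintro _ ⟨n, ρ, rfl⟩
    exact Subring.subset_closure ⟨n, ρ.comp φ, rfl⟩⟩
  map_one' := rfl
  map_mul' _ _ := rfl
  map_zero' := rfl
  map_add' _ _ := rfl

theorem resVirtual_virtualCharacter {G H A : Type*} [Group G] [Group H] [AddCommGroup A]
    [Module ℂ A] [Module.Finite ℂ A] (φ : H →* G) (ρ : Representation ℂ G A) :
    resVirtual φ (virtualCharacter ρ) = virtualCharacter (ρ.comp φ) := rfl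

theorem complexCharacters_closure (G : Type*) [Group G] :
    (Submonoid.closure (complexCharacters G) : Set (G → ℂ)) = complexCharacters G := by
  let S : Submonoid (G → ℂ) :=
    { carrier := complexCharacters G
      one_mem' := by
        have : (1 : G → ℂ) = (Representation.trivial ℂ G ℂ).character := by
          funext g
          simp [Representation.character]
        rw [this]
        exact character_mem_complexCharacters _
      mul_mem' := by
        rintro _ _ ⟨n, ρ, rfl⟩ ⟨m, σ, rfl⟩
        rw [← Representation.char_tensor]
        exact character_mem_complexCharacters _ }
  exact Set.Subset.antisymm
    ((Submonoid.closure_le (S := S)).2 (fun _ h => h)) Submonoid.subset_closure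

theorem trace_of_basis_perm {ι A : Type*} [Fintype ι] [DecidableEq ι] [AddCommGroup A]
    [Module ℂ A] (b : Module.Basis ι ℂ A) (σ : ι → ι) (f : A →ₗ[ℂ] A)
    (hf : ∀ i, f (b i) = b (σ i)) :
    LinearMap.trace ℂ A f = ∑ i, if σ i = i then (1 : ℂ) else 0 := by
  rw [LinearMap.trace_eq_matrix_trace ℂ b, Matrix.trace]
  refine Finset.sum_congr rfl fun i _ => ?_
  simp [LinearMap.toMatrix_apply, hf, Finsupp.single_apply]

open Classical in
/-- Frobenius' formula for the function on `G` induced by a function on the subgroup `H`. -/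
noncomputable def frobeniusInd {G : Type*} [Group G] [Finite G] (H : Subgroup G) :
    (H → ℂ) →+ (G → ℂ) :=
  letI := Fintype.ofFinite G
  { toFun := fun χ g => (Nat.card H : ℂ)⁻¹ *
      ∑ x : G, if hx : x⁻¹ * g * x ∈ H then χ ⟨x⁻¹ * g * x, hx⟩ else 0
    map_zero' := by funext g; simp
    map_add' := fun χ ψ => by
      funext g
      simp only [Pi.add_apply]
      rw [← mul_add, ← Finset.sum_add_distrib]
      congr 1
      refine Finset.sum_congr rfl fun x _ => ?_
      split_ifs <;> simp }

theorem trace_coinvariants {H W : Type*} [Group H] [Fintype H] [AddCommGroup W] [Module ℂ W]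
    [Module.Finite ℂ W] (τ : Representation ℂ H W) (f : τ.Coinvariants →ₗ[ℂ] τ.Coinvariants)
    (F : W →ₗ[ℂ] W)
    (hfF : f ∘ₗ Representation.Coinvariants.mk τ = Representation.Coinvariants.mk τ ∘ₗ F) :
    LinearMap.trace ℂ _ f
      = (Fintype.card H : ℂ)⁻¹ * ∑ h, LinearMap.trace ℂ W (τ h ∘ₗ F) := by
  set e : W →ₗ[ℂ] W := (Fintype.card H : ℂ)⁻¹ • ∑ h, τ h with he
  have hcard : (Fintype.card H : ℂ) ≠ 0 := by simp
  have hinv : ∀ h, e ∘ₗ τ h = e := by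
    intro h
    ext x
    simp only [he, LinearMap.comp_apply, LinearMap.smul_apply, LinearMap.sum_apply]
    congr 1
    simp_rw [← Module.End.mul_apply, ← map_mul]
    exact Fintype.sum_equiv (Equiv.mulRight h) _ _ fun _ => rfl
  let s : τ.Coinvariants →ₗ[ℂ] W := Representation.Coinvariants.lift τ e hinv
  have hs : s ∘ₗ Representation.Coinvariants.mk τ = e :=
    Representation.Coinvariants.lift_comp_mk τ e hinv
  have hπ : Representation.Coinvariants.mk τ ∘ₗ s = LinearMap.id := by
    apply Representation.Coinvariants.hom_ext
    rw [LinearMap.comp_assoc, hs]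
    ext x
    simp only [he, LinearMap.comp_apply, LinearMap.smul_apply, LinearMap.sum_apply, map_smul,
      map_sum, Representation.Coinvariants.mk_self_apply, LinearMap.id_apply, Finset.sum_const,
      Finset.card_univ]
    rw [← Nat.cast_smul_eq_nsmul ℂ, smul_smul, inv_mul_cancel₀ hcard, one_smul]
  have h1 : f = Representation.Coinvariants.mk τ ∘ₗ (F ∘ₗ s) := by
    rw [← LinearMap.comp_assoc, ← hfF, LinearMap.comp_assoc, hπ, LinearMap.comp_id]
  rw [h1, LinearMap.trace_comp_comm', LinearMap.comp_assoc, hs, LinearMap.trace_comp_comm', he,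
    LinearMap.smul_comp, map_smul, smul_eq_mul]
  rw [← map_sum (LinearMap.trace ℂ W)]
  congr 2
  exact Finset.sum_mul Finset.univ τ F

/-- The character of the induced representation `ℂG ⊗_{ℂH} A` is given by Frobenius' formula. -/
theorem character_ind {G A : Type*} [Group G] [Finite G] (H : Subgroup G) [AddCommGroup A]
    [Module ℂ A] [Module.Finite ℂ A] (ρ : Representation ℂ H A) :
    (Representation.ind H.subtype ρ).character = frobeniusInd H ρ.character := by
  classical
  let _ := Fintype.ofFinite G
  funext g
  unfold Representation.character
  rw [trace_coinvariants _ (Representation.ind H.subtype ρ g)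
    ((MonoidAlgebra.mapDomainLinearMap ℂ ℂ fun x => x * g⁻¹).rTensor A) rfl]
  have key : ∀ h : H, LinearMap.trace ℂ _
      ((Representation.tprod ((Representation.leftRegular ℂ G).comp H.subtype) ρ) h ∘ₗ
        ((MonoidAlgebra.mapDomainLinearMap ℂ ℂ fun x : G => x * g⁻¹).rTensor A))
      = ∑ x : G, if x * g * x⁻¹ = h then LinearMap.trace ℂ A (ρ h) else 0 := by
    intro h
    have : (Representation.tprod ((Representation.leftRegular ℂ G).comp H.subtype) ρ) h ∘ₗ
        ((MonoidAlgebra.mapDomainLinearMap ℂ ℂ fun x : G => x * g⁻¹).rTensor A)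
        = TensorProduct.map (Representation.leftRegular ℂ G (h : G) ∘ₗ
          (MonoidAlgebra.mapDomainLinearMap ℂ ℂ fun x : G => x * g⁻¹)) (ρ h) := by
      apply TensorProduct.ext'
      intro a b
      simp
    rw [this, LinearMap.trace_tensorProduct', trace_of_basis_perm (MonoidAlgebra.basis G ℂ)
      (fun x => (h : G) * (x * g⁻¹)) _ (by intro i; simp), Finset.sum_mul]
    refine Finset.sum_congr rfl fun x _ => ?_
    have : (h : G) * (x * g⁻¹) = x ↔ x * g * x⁻¹ = h := by
      constructor
      · intro hx
        rw [mul_inv_eq_iff_eq_mul]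
        nth_rewrite 1 [← hx]
        group
      · intro hx
        rw [← hx]
        group
    by_cases hx : x * g * x⁻¹ = h
    · rw [if_pos hx, if_pos (this.2 hx), one_mul]
    · rw [if_neg hx, if_neg (fun h' => hx (this.1 h')), zero_mul]
  simp_rw [key]
  rw [Finset.sum_comm]
  simp only [frobeniusInd, AddMonoidHom.coe_mk, ZeroHom.coe_mk, Nat.card_eq_fintype_card]
  congr 1
  refine Fintype.sum_equiv (Equiv.inv G) _ _ fun x => ?_
  simp only [Equiv.inv_apply, inv_inv]
  split_ifs with hx
  · rw [Finset.sum_eq_single (⟨x * g * x⁻¹, hx⟩ : H)]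
    · simp
    · intro b _ hb
      rw [if_neg]
      intro h'
      exact hb (Subtype.ext h'.symm)
    · simp
  · refine Finset.sum_eq_zero fun b _ => if_neg ?_
    intro h'
    exact hx (h' ▸ b.2)

theorem frobeniusInd_mem {G : Type*} [Group G] [Finite G] (H : Subgroup G) (χ : H → ℂ)
    (hχ : χ ∈ VirtualCharacterRing H) : frobeniusInd H χ ∈ VirtualCharacterRing G := by
  rw [VirtualCharacterRing, Subring.mem_closure_iff, complexCharacters_closure] at hχ
  have hle : AddSubgroup.closure (complexCharacters H) ≤
      (VirtualCharacterRing G).toAddSubgroup.comap (frobeniusInd H) := by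
    rw [AddSubgroup.closure_le]
    rintro _ ⟨n, ρ, rfl⟩
    change frobeniusInd H ρ.character ∈ VirtualCharacterRing G
    rw [← character_ind]
    exact Subring.subset_closure (character_mem_complexCharacters _)
  exact hle hχ

/-- Induction of virtual characters from a subgroup `H` of `G`. -/
noncomputable def indVirtual {G : Type*} [Group G] [Finite G] (H : Subgroup G) :
    VirtualCharacterRing H →+ VirtualCharacterRing G where
  toFun χ := ⟨frobeniusInd H χ.1, frobeniusInd_mem H χ.1 χ.2⟩
  map_zero' := Subtype.ext (map_zero (frobeniusInd H))
  map_add' χ ψ := Subtype.ext (map_add (frobeniusInd H) χ.1 ψ.1)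

/-- `indVirtual H` is the additive map that sends the class of a representation `ρ` of `H` to the
class of the induced representation `ℂG ⊗_{ℂH} ρ`. -/
theorem indVirtual_virtualCharacter {G A : Type*} [Group G] [Finite G] (H : Subgroup G)
    [AddCommGroup A] [Module ℂ A] [Module.Finite ℂ A] (ρ : Representation ℂ H A) :
    indVirtual H (virtualCharacter ρ) = virtualCharacter (Representation.ind H.subtype ρ) :=
  Subtype.ext (character_ind H ρ).symm

/-- Coefficientwise restriction `R_G[[t]] → R_H[[t]]`. -/
noncomputable def resSeries {G H : Type*} [Group G] [Group H] (φ : H →* G)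
    (f : PowerSeries (VirtualCharacterRing G)) : PowerSeries (VirtualCharacterRing H) :=
  PowerSeries.map (resVirtual φ) f

/-- Coefficientwise induction `R_H[[t]] → R_G[[t]]`. -/
noncomputable def indSeries {G : Type*} [Group G] [Finite G] (H : Subgroup G)
    (f : PowerSeries (VirtualCharacterRing H)) : PowerSeries (VirtualCharacterRing G) :=
  PowerSeries.mk fun n => indVirtual H (PowerSeries.coeff n f)

/-- The `i`-th exterior power of a representation. -/
noncomputable def exteriorPowerRep {G A : Type*} [Group G] [AddCommGroup A] [Module ℂ A]
    (ρ : Representation ℂ G A) (i : ℕ) : Representation ℂ G (⋀[ℂ]^i A) where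
  toFun g := exteriorPower.map i (ρ g)
  map_one' := by rw [map_one]; exact exteriorPower.map_id
  map_mul' g h := by rw [map_mul]; exact exteriorPower.map_comp (ρ h) (ρ g)

/-- The polynomial `det(Id - ρ t) = ∑ i, (-1)^i [⋀^i ρ] t^i` in `R_G[t]`. -/
noncomputable def detIdSub {G A : Type*} [Group G] [AddCommGroup A] [Module ℂ A]
    [Module.Finite ℂ A] (ρ : Representation ℂ G A) : Polynomial (VirtualCharacterRing G) :=
  ∑ i ∈ Finset.range (Module.finrank ℂ A + 1),
    Polynomial.monomial i ((-1) ^ i * virtualCharacter (exteriorPowerRep ρ i))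

end VirtualCharacters

/-! ### Posets with an edge labeling -/

/-- A partial order on `V` with an edge labeling, that is, a map from the set of covering
relations to `{1, -1}`; the labeling is extended by `0` to the pairs that are not covering
relations, so that it carries no further data. -/
@[ext]
structure SignedPoset (V : Type*) where
  order : PartialOrder V
  sign : V → V → ℤ
  sign_of_covBy : ∀ x y, @CovBy V order.toLT x y → sign x y = 1 ∨ sign x y = -1
  sign_of_not_covBy : ∀ x y, ¬ @CovBy V order.toLT x y → sign x y = 0

namespace SignedPoset

variable {V : Type*}

/-- The relation `x ≤ y` of the poset. -/
def le (P : SignedPoset V) (x y : V) : Prop := P.order.le x y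

/-- The relation `x < y` of the poset. -/
def lt (P : SignedPoset V) (x y : V) : Prop := P.order.lt x y

/-- `x ⋖ y` is a covering relation of the poset. -/
def cov (P : SignedPoset V) (x y : V) : Prop := @CovBy V P.order.toLT x y

/-- `x` is a minimal element of the poset. -/
def IsMinimal (P : SignedPoset V) (x : V) : Prop := ∀ z, ¬ P.lt z x

/-- `P.SatChain x y L`: there is a saturated chain `x = p₀ ⋖ p₁ ⋖ ⋯ ⋖ pₘ = y` whose list of
edge labels is `L`. -/
inductive SatChain (P : SignedPoset V) : V → V → List ℤ → Prop
  | nil (x : V) : SatChain P x x []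
  | cons {x y z : V} {L : List ℤ} (h : P.cov x y) (hL : SatChain P y z L) :
      SatChain P x z (P.sign x y :: L)

/-- `(P, ε)` is sign-consistent: for each `y`, all the maximal saturated chains of the principal
order ideal of `y` (they start at a minimal element and end at `y`) have the same sum of labels. -/
def Consistent (P : SignedPoset V) : Prop :=
  ∀ (y x x' : V) (L L' : List ℤ), P.IsMinimal x → P.IsMinimal x' →
    P.SatChain x y L → P.SatChain x' y L' → L.sum = L'.sum

/-- The rank of `y` in a sign-consistent poset: the sum of the labels of any maximal saturated
chain of the principal order ideal of `y`. -/
noncomputable def rank (P : SignedPoset V) (y : V) : ℤ :=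
  Classical.epsilon fun r : ℤ => ∃ (x : V) (L : List ℤ),
    P.IsMinimal x ∧ P.SatChain x y L ∧ L.sum = r

/-- The pair `p < q` is ascending: each saturated chain from `p` to `q` has all labels `1`. -/
def Ascending (P : SignedPoset V) (p q : V) : Prop :=
  P.lt p q ∧ ∀ L, P.SatChain p q L → ∀ e ∈ L, e = 1

/-- The pair `p < q` is nonascending. -/
def Nonascending (P : SignedPoset V) (p q : V) : Prop := P.lt p q ∧ ¬ P.Ascending p q

/-- `(Q, δ)` is a saturation of `(P, ε)`. -/
structure IsSaturation (P Q : SignedPoset V) : Prop where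
  consistent : Q.Consistent
  saturated : ∀ x y, |Q.rank y - Q.rank x| = 1 → Q.le x y ∨ Q.le y x
  extends_order : ∀ x y, P.lt x y → Q.lt x y
  rank_eq : ∀ x, Q.rank x = P.rank x

/-! ### Automorphisms and the action on labeled posets -/

theorem perm_apply_inv (g : Equiv.Perm V) (x : V) : g (g⁻¹ x) = x := Equiv.apply_symm_apply g x

theorem perm_inv_apply (g : Equiv.Perm V) (x : V) : g⁻¹ (g x) = x := Equiv.symm_apply_apply g x

theorem lt_iff (P : SignedPoset V) (x y : V) : P.lt x y ↔ P.le x y ∧ ¬ P.le y x :=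
  P.order.lt_iff_le_not_ge x y

theorem cov_iff (P : SignedPoset V) (x y : V) :
    P.cov x y ↔ P.lt x y ∧ ∀ z, P.lt x z → ¬ P.lt z y := Iff.rfl

theorem lt_map_iff {P : SignedPoset V} {g : Equiv.Perm V}
    (hg : ∀ x y, P.le (g x) (g y) ↔ P.le x y) (x y : V) : P.lt (g x) (g y) ↔ P.lt x y := by
  rw [lt_iff, lt_iff, hg, hg]

theorem cov_map_iff {P : SignedPoset V} {g : Equiv.Perm V}
    (hg : ∀ x y, P.le (g x) (g y) ↔ P.le x y) (x y : V) : P.cov (g x) (g y) ↔ P.cov x y := by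
  rw [cov_iff, cov_iff, lt_map_iff hg]
  refine and_congr_right fun _ => ⟨fun h z => ?_, fun h z => ?_⟩
  · have := h (g z)
    rwa [lt_map_iff hg, lt_map_iff hg] at this
  · have := h (g⁻¹ z)
    rwa [← lt_map_iff hg x, ← lt_map_iff hg _ y, perm_apply_inv] at this

/-- The group `Aut(P, ε)` of the automorphisms of the poset that preserve the labeling. -/
def aut (P : SignedPoset V) : Subgroup (Equiv.Perm V) where
  carrier := {g | (∀ x y, P.le (g x) (g y) ↔ P.le x y) ∧
    ∀ x y, P.cov x y → P.sign (g x) (g y) = P.sign x y}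
  one_mem' := ⟨fun _ _ => Iff.rfl, fun _ _ _ => rfl⟩
  mul_mem' := by
    rintro g h ⟨hg, hg'⟩ ⟨hh, hh'⟩
    refine ⟨fun x y => (hg _ _).trans (hh _ _), fun x y hxy => ?_⟩
    exact (hg' _ _ ((cov_map_iff hh x y).2 hxy)).trans (hh' _ _ hxy)
  inv_mem' := by
    rintro g ⟨hg, hg'⟩
    have hi : ∀ x y, P.le (g⁻¹ x) (g⁻¹ y) ↔ P.le x y := fun x y => by
      rw [← hg, perm_apply_inv, perm_apply_inv]
    refine ⟨hi, fun x y hxy => ?_⟩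
    have := hg' _ _ ((cov_map_iff hi x y).2 hxy)
    rw [perm_apply_inv, perm_apply_inv] at this
    exact this.symm

/-- The poset `gQ`: one has `x < y` in `gQ` if and only if `g⁻¹ x < g⁻¹ y` in `Q`, and the label of
`x ⋖ y` in `gQ` is the label of `g⁻¹ x ⋖ g⁻¹ y` in `Q`. -/
def translate (g : Equiv.Perm V) (Q : SignedPoset V) : SignedPoset V :=
  have hcov : ∀ x y,
      @CovBy V (@PartialOrder.lift V V Q.order (fun x => g⁻¹ x) (Equiv.injective g⁻¹)).toLT x y ↔
        Q.cov (g⁻¹ x) (g⁻¹ y) := fun x y => by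
    refine and_congr_right fun _ => ⟨fun h z hz hz' => ?_, fun h z => h (c := g⁻¹ z)⟩
    refine @h (g z) ?_ ?_
    · change Q.lt (g⁻¹ x) (g⁻¹ (g z))
      rwa [perm_inv_apply]
    · change Q.lt (g⁻¹ (g z)) (g⁻¹ y)
      rwa [perm_inv_apply]
  { order := @PartialOrder.lift V V Q.order (fun x => g⁻¹ x) (Equiv.injective g⁻¹)
    sign := fun x y => Q.sign (g⁻¹ x) (g⁻¹ y)
    sign_of_covBy := fun x y h => Q.sign_of_covBy _ _ ((hcov x y).1 h)
    sign_of_not_covBy := fun x y h => Q.sign_of_not_covBy _ _ fun h' => h ((hcov x y).2 h') }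

theorem ext_le_sign {P Q : SignedPoset V} (h : ∀ x y, P.le x y ↔ Q.le x y)
    (h' : ∀ x y, P.sign x y = Q.sign x y) : P = Q :=
  SignedPoset.ext (PartialOrder.ext h) (funext fun x => funext fun y => h' x y)

instance : MulAction (Equiv.Perm V) (SignedPoset V) where
  smul := translate
  one_smul _ := ext_le_sign (fun _ _ => Iff.rfl) (fun _ _ => rfl)
  mul_smul _ _ _ := ext_le_sign (fun _ _ => Iff.rfl) (fun _ _ => rfl)

theorem mem_aut_of_smul_eq {g : Equiv.Perm V} {Q : SignedPoset V} (h : g • Q = Q) :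
    g ∈ Q.aut := by
  have h1 : ∀ x y, Q.le (g x) (g y) ↔ Q.le x y := fun x y => by
    conv_lhs => rw [← h]
    change Q.le (g⁻¹ (g x)) (g⁻¹ (g y)) ↔ _
    rw [perm_inv_apply, perm_inv_apply]
  refine ⟨h1, fun x y _ => ?_⟩
  conv_lhs => rw [← h]
  change Q.sign (g⁻¹ (g x)) (g⁻¹ (g y)) = _
  rw [perm_inv_apply, perm_inv_apply]

/-- The inclusion of the stabilizer of `(Q, δ)` in a group `G` of permutations into
`Aut(Q, δ)`. -/
def stabToAut (G : Subgroup (Equiv.Perm V)) (Q : SignedPoset V) :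
    MulAction.stabilizer G Q →* Q.aut where
  toFun g := ⟨((g : G) : Equiv.Perm V), mem_aut_of_smul_eq g.2⟩
  map_one' := rfl
  map_mul' _ _ := rfl

/-! ### The order polytope and its equivariant Ehrhart theory -/

/-- The (partly open) order polytope of `(P, ε)`. -/
def orderPolytope (P : SignedPoset V) : Set (V → ℝ) :=
  {f | (∀ v, 0 ≤ f v ∧ f v ≤ 1) ∧ (∀ p q, P.le p q → f q ≤ f p) ∧
    ∀ p q, P.Nonascending p q → f q < f p}

open Classical in
/-- The `m`-th dilation of the order polytope; for `m = 0` it is by convention the singleton of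
the zero function if all the edge labels are `1`, and the empty set otherwise. -/
noncomputable def dilation (P : SignedPoset V) (m : ℕ) : Set (V → ℝ) :=
  if m = 0 then (if ∀ x y, P.cov x y → P.sign x y = 1 then {0} else ∅)
  else (fun (f : V → ℝ) v => (m : ℝ) * f v) '' P.orderPolytope

/-- The lattice points of the `m`-th dilation of the order polytope. -/
def latticePoints (P : SignedPoset V) (m : ℕ) : Set (V → ℤ) :=
  {f | (fun v => (f v : ℝ)) ∈ P.dilation m}

theorem SatChain.map {P : SignedPoset V} {g : Equiv.Perm V} (hg : g ∈ P.aut) {x y : V}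
    {L : List ℤ} (h : P.SatChain x y L) : P.SatChain (g x) (g y) L := by
  induction h with
  | nil x => exact SatChain.nil _
  | cons h _ ih =>
    rw [← hg.2 _ _ h]
    exact SatChain.cons ((cov_map_iff hg.1 _ _).2 h) ih

theorem Nonascending.map {P : SignedPoset V} {g : Equiv.Perm V} (hg : g ∈ P.aut) {x y : V}
    (h : P.Nonascending x y) : P.Nonascending (g x) (g y) := by
  refine ⟨(lt_map_iff hg.1 _ _).2 h.1, fun h' => h.2 ⟨h.1, fun L hL => h'.2 L (hL.map hg)⟩⟩

theorem dilation_comp {P : SignedPoset V} {g : Equiv.Perm V} (hg : g ∈ P.aut) {m : ℕ}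
    {f : V → ℝ} (hf : f ∈ P.dilation m) : f ∘ g ∈ P.dilation m := by
  unfold dilation at hf ⊢
  split_ifs at hf ⊢ with h0 h1
  · rw [Set.mem_singleton_iff] at hf ⊢
    rw [hf]
    rfl
  · exact hf
  · obtain ⟨f, hf, rfl⟩ := hf
    exact ⟨f ∘ g, ⟨fun v => hf.1 _, fun p q h => hf.2.1 _ _ ((hg.1 _ _).2 h),
      fun p q h => hf.2.2 _ _ (h.map hg)⟩, rfl⟩

/-- The action `f ↦ f ∘ g⁻¹` of `Aut(P, ε)` on the lattice points of the `m`-th dilation. -/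
def latticeAction (P : SignedPoset V) (m : ℕ) : P.aut →* Equiv.Perm (P.latticePoints m) where
  toFun g :=
    { toFun := fun f => ⟨f.1 ∘ ⇑(g : Equiv.Perm V)⁻¹, dilation_comp (P.aut.inv_mem g.2) f.2⟩
      invFun := fun f => ⟨f.1 ∘ ⇑(g : Equiv.Perm V), dilation_comp g.2 f.2⟩
      left_inv := fun f => by ext; simp
      right_inv := fun f => by ext; simp }
  map_one' := rfl
  map_mul' _ _ := rfl

instance [Finite V] (P : SignedPoset V) (m : ℕ) : Finite (P.latticePoints m) := by
  refine Set.Finite.subset (Set.Finite.pi' fun _ : V => Set.finite_Icc (0 : ℤ) m) ?_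
  intro f hf v
  unfold latticePoints dilation at hf
  rw [Set.mem_ofPred_eq] at hf
  have key : (0 : ℝ) ≤ f v ∧ (f v : ℝ) ≤ m := by
    split_ifs at hf with h0 h1
    · have := congrFun (Set.mem_singleton_iff.1 hf) v
      simp only [Pi.zero_apply] at this
      simp [this]
    · exact absurd hf (Set.notMem_empty _)
    · obtain ⟨k, hk, hkf⟩ := hf
      have := congrFun hkf v
      simp only at this
      rw [← this]
      have hm : (0 : ℝ) ≤ m := Nat.cast_nonneg m
      exact ⟨mul_nonneg hm (hk.1 v).1, mul_le_of_le_one_right hm (hk.1 v).2⟩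
  exact ⟨by exact_mod_cast key.1, by exact_mod_cast key.2⟩

/-- The complex permutation representation of `G ≤ Aut(P, ε)` on the lattice points of the `m`-th
dilation of the order polytope. -/
noncomputable def latticeRep (P : SignedPoset V) {G : Subgroup (Equiv.Perm V)} (hG : G ≤ P.aut)
    (m : ℕ) : Representation ℂ G (MonoidAlgebra ℂ (P.latticePoints m)) :=
  (Representation.ofMulAction ℂ (Equiv.Perm (P.latticePoints m)) (P.latticePoints m)).comp
    ((P.latticeAction m).comp (Subgroup.inclusion hG))

/-- The equivariant Ehrhart series of the order polytope, in `R_G[[t]]`. -/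
noncomputable def ehrhartSeries [Finite V] (P : SignedPoset V) {G : Subgroup (Equiv.Perm V)}
    (hG : G ≤ P.aut) : PowerSeries (VirtualCharacterRing G) :=
  PowerSeries.mk fun m => virtualCharacter (P.latticeRep hG m)

/-- The representation of a group of permutations of `V` on `ℂ^V` by `f ↦ f ∘ g⁻¹`. -/
noncomputable def permRep (G : Subgroup (Equiv.Perm V)) : Representation ℂ G (V → ℂ) where
  toFun g := LinearMap.funLeft ℂ ℂ ⇑(g : Equiv.Perm V)⁻¹
  map_one' := rfl
  map_mul' _ _ := rfl

/-- The extension of `permRep` to `ℂ^V ⊕ ℂ`, with trivial action on the second summand. -/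
noncomputable def permRepExt (G : Subgroup (Equiv.Perm V)) :
    Representation ℂ G ((V → ℂ) × ℂ) :=
  (permRep G).prod (Representation.trivial ℂ G ℂ)

/-- The equivariant `h^*`-series of the order polytope, in `R_G[[t]]`. -/
noncomputable def hStar [Finite V] (P : SignedPoset V) (G : Subgroup (Equiv.Perm V))
    (hG : G ≤ P.aut) : PowerSeries (VirtualCharacterRing G) :=
  P.ehrhartSeries hG * (detIdSub (permRepExt G) : PowerSeries (VirtualCharacterRing G))

end SignedPoset

/-! The identity rests on a decomposition of lattice points. Write `ρ` for the rank function of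
`(P, ε)`. The lattice points of `m𝒪(P, ε)` are the `(P, ε)`-partitions with values in `[0, m]`
(`SignedPoset.mem_latticePoints_iff`; this includes `m = 0`). Each of them, `f` say, belongs to
exactly one saturation of `(P, ε)`
(`SignedPoset.existsUnique_saturation_of_mem_latticePoints`): if `f` is a `(Q, δ)`-partition, then
a covering relation `x ⋖ y` of `Q` changes `ρ` by one, and `f` drops along it unless `f` is constant
and `ρ` goes up. Conversely, two elements related in this way are comparable in `Q`, and in no other
direction. Hence the order of `Q` is the transitive closure of that relation,
`SignedPoset.Link ρ f`, and the labels are the differences of `ρ`. The closure is always a partial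
order, because it decreases the pair `(f, -ρ)` lexicographically, and it is a saturation of `P` when
`f` is a `(P, ε)`-partition.

Both series are then compared at a group element `g`. The character of `G` on the lattice points
counts the fixed points of `g`; a fixed point lies in a saturation that is fixed by `g`, by
uniqueness, and sorting the fixed points by saturation gives Frobenius' formula for the sum of the
induced characters (`SignedPoset.ncard_fixedLatticePoints_eq_sum`). So the equivariant Ehrhart
series satisfies the asserted identity (`SignedPoset.ehrhartSeries_eq_sum`). The determinant factors
of the `Q i` and of `P` restrict to the same series of the stabilizers, so the projection formula
`indSeries_mul_res` carries the identity over to the `h^*`-series. -/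

/-! ### Saturated chains, ranks and the covering relation -/

namespace SignedPoset

open Relation

variable {V : Type*} {P Q : SignedPoset V}

theorem lt_of_le_of_lt' {x y z : V} (h : P.le x y) (h' : P.lt y z) : P.lt x z :=
  letI := P.order
  lt_of_le_of_lt (α := V) h h'

theorem le_trans' {x y z : V} (h : P.le x y) (h' : P.le y z) : P.le x z :=
  letI := P.order
  le_trans (α := V) h h'

theorem le_refl' (x : V) : P.le x x := P.order.le_refl x

theorem lt_trans' {x y z : V} (h : P.lt x y) (h' : P.lt y z) : P.lt x z :=
  letI := P.order
  lt_trans (α := V) h h'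

theorem le_iff_eq_or_lt {x y : V} : P.le x y ↔ x = y ∨ P.lt x y :=
  letI := P.order
  _root_.le_iff_eq_or_lt

theorem le_of_lt' {x y : V} (h : P.lt x y) : P.le x y := le_iff_eq_or_lt.2 (Or.inr h)

theorem lt_of_cov {x y : V} (h : P.cov x y) : P.lt x y := h.1

theorem le_of_cov {x y : V} (h : P.cov x y) : P.le x y := le_of_lt' h.1

theorem lt_iff_transGen_cov [Finite V] {x y : V} : P.lt x y ↔ TransGen P.cov x y := by
  classical
  let := P.order
  let := Fintype.ofFinite V
  let : DecidableLE V := Classical.decRel _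
  let : LocallyFiniteOrder V := Fintype.toLocallyFiniteOrder
  exact lt_iff_transGen_covBy (α := V)

theorem le_iff_reflTransGen_cov [Finite V] {x y : V} : P.le x y ↔ ReflTransGen P.cov x y := by
  rw [reflTransGen_iff_eq_or_transGen, le_iff_eq_or_lt, ← lt_iff_transGen_cov, eq_comm]

theorem SatChain.le {x y : V} {L : List ℤ} (h : P.SatChain x y L) : P.le x y := by
  induction h with
  | nil x => exact le_refl' x
  | cons h _ ih => exact le_trans' (le_of_cov h) ih

theorem SatChain.append {x y z : V} {L L' : List ℤ} (h : P.SatChain x y L)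
    (h' : P.SatChain y z L') : P.SatChain x z (L ++ L') := by
  induction h with
  | nil x => exact h'
  | cons h _ ih => exact .cons h (ih h')

theorem SatChain.snoc {x y z : V} {L : List ℤ} (h : P.SatChain x y L)
    (h' : P.cov y z) : P.SatChain x z (L ++ [P.sign y z]) :=
  h.append (.cons h' (.nil z))

theorem exists_satChain [Finite V] {x y : V} (h : P.le x y) : ∃ L, P.SatChain x y L := by
  rw [le_iff_reflTransGen_cov] at h
  induction h with
  | refl => exact ⟨[], .nil _⟩
  | tail _ h ih =>
    obtain ⟨L, hL⟩ := ih
    exact ⟨_, hL.snoc h⟩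

theorem exists_minimal_satChain [Finite V] (P : SignedPoset V) (y : V) :
    ∃ x L, P.IsMinimal x ∧ P.SatChain x y L := by
  obtain ⟨x, hxy, hx⟩ : ∃ x, P.le x y ∧ P.IsMinimal x := by
    let := P.order
    obtain ⟨x, hxy, hx⟩ := (Set.toFinite (Set.univ : Set V)).exists_le_minimal (Set.mem_univ y)
    exact ⟨x, hxy, fun z hz => hx.not_lt (Set.mem_univ z) hz⟩
  obtain ⟨L, hL⟩ := exists_satChain hxy
  exact ⟨x, L, hx, hL⟩

theorem Consistent.rank_eq (hP : P.Consistent) {x y : V} {L : List ℤ} (hx : P.IsMinimal x)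
    (hL : P.SatChain x y L) : P.rank y = L.sum := by
  obtain ⟨x', L', hx', hL', h⟩ := Classical.epsilon_spec
    (p := fun r : ℤ => ∃ (x : V) (L : List ℤ), P.IsMinimal x ∧ P.SatChain x y L ∧ L.sum = r)
    ⟨_, x, L, hx, hL, rfl⟩
  exact h.symm.trans (hP y x' x L' L hx' hx hL' hL)

theorem Consistent.rank_of_isMinimal (hP : P.Consistent) {x : V} (hx : P.IsMinimal x) :
    P.rank x = 0 := hP.rank_eq hx (.nil x)

theorem Consistent.rank_of_cov [Finite V] (hP : P.Consistent) {x y : V} (h : P.cov x y) :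
    P.rank y = P.rank x + P.sign x y := by
  obtain ⟨z, L, hz, hL⟩ := P.exists_minimal_satChain x
  rw [hP.rank_eq hz hL, hP.rank_eq hz (hL.snoc h)]
  simp

theorem sign_of_cov {x y : V} (h : P.cov x y) : P.sign x y = 1 ∨ P.sign x y = -1 :=
  P.sign_of_covBy x y h

/-- A potential for the labeling that vanishes on the minimal elements certifies consistency and
computes the rank. -/
theorem consistent_and_rank_of_potential [Finite V] {ρ : V → ℤ}
    (h0 : ∀ x, P.IsMinimal x → ρ x = 0) (hρ : ∀ x y, P.cov x y → P.sign x y = ρ y - ρ x) :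
    P.Consistent ∧ P.rank = ρ := by
  have hsum : ∀ {x y L}, P.SatChain x y L → L.sum = ρ y - ρ x := by
    intro x y L hL
    induction hL with
    | nil x => simp
    | cons h _ ih => rw [List.sum_cons, ih, hρ _ _ h]; ring
  have hP : P.Consistent := fun y x x' L L' hx hx' hL hL' => by
    rw [hsum hL, hsum hL', h0 x hx, h0 x' hx']
  refine ⟨hP, funext fun y => ?_⟩
  obtain ⟨x, L, hx, hL⟩ := P.exists_minimal_satChain y
  rw [hP.rank_eq hx hL, hsum hL, h0 x hx, sub_zero]

theorem nonascending_iff [Finite V] {x y : V} :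
    P.Nonascending x y ↔
      ∃ z w, P.le x z ∧ P.cov z w ∧ P.le w y ∧ P.sign z w = -1 := by
  constructor
  · rintro ⟨hlt, hna⟩
    have : ∃ L, P.SatChain x y L ∧ ∃ e ∈ L, e ≠ 1 := by
      by_contra! h
      exact hna ⟨hlt, h⟩
    obtain ⟨L, hL, e, he, he1⟩ := this
    clear hlt hna
    induction hL with
    | nil x => simp at he
    | @cons x y z L h hL ih =>
      rcases List.mem_cons.1 he with rfl | he
      · exact ⟨x, y, le_refl' x, h, hL.le, (sign_of_cov h).resolve_left he1⟩
      · obtain ⟨a, b, ha, hab, hb, hs⟩ := ih he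
        exact ⟨a, b, le_trans' (le_of_cov h) ha, hab, hb, hs⟩
  · rintro ⟨z, w, hxz, hzw, hwy, hs⟩
    obtain ⟨L, hL⟩ := exists_satChain hxz
    obtain ⟨L', hL'⟩ := exists_satChain hwy
    refine ⟨lt_of_le_of_lt' hxz ?_, fun h => ?_⟩
    · rcases le_iff_eq_or_lt.1 hwy with rfl | h
      · exact lt_of_cov hzw
      · exact lt_trans' (lt_of_cov hzw) h
    · have := h.2 _ (hL.append (.cons hzw hL')) (P.sign z w) (by simp)
      omega

/-! ### Lattice points as order-reversing functions -/

/-- The `(P, ε)`-partitions: the order-reversing integer functions that drop strictly along the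
covering relations with label `-1`. -/
def IsPartition (P : SignedPoset V) (f : V → ℤ) : Prop :=
  ∀ x y, P.cov x y → f y ≤ f x ∧ (P.sign x y = -1 → f y < f x)

theorem IsPartition.antitone [Finite V] {f : V → ℤ} (hf : P.IsPartition f) {x y : V}
    (h : P.le x y) : f y ≤ f x := by
  rw [le_iff_reflTransGen_cov] at h
  induction h with
  | refl => exact le_rfl
  | tail _ h ih => exact (hf _ _ h).1.trans ih

theorem IsPartition.lt_of_nonascending [Finite V] {f : V → ℤ} (hf : P.IsPartition f) {x y : V}
    (h : P.Nonascending x y) : f y < f x := by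
  obtain ⟨z, w, hxz, hzw, hwy, hs⟩ := nonascending_iff.1 h
  exact (hf.antitone hwy).trans_lt (((hf z w hzw).2 hs).trans_le (hf.antitone hxz))

theorem isPartition_iff [Finite V] {f : V → ℤ} :
    P.IsPartition f ↔
      (∀ x y, P.le x y → f y ≤ f x) ∧ ∀ x y, P.Nonascending x y → f y < f x :=
  ⟨fun hf => ⟨fun _ _ => hf.antitone, fun _ _ => hf.lt_of_nonascending⟩,
    fun hf _ _ h => ⟨hf.1 _ _ (le_of_cov h), fun hs => hf.2 _ _
      (nonascending_iff.2 ⟨_, _, le_refl' _, h, le_refl' _, hs⟩)⟩⟩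

/-- The convention for `m = 0` agrees with the general description: the zero function is a
`(P, ε)`-partition exactly when no covering relation has label `-1`. -/
theorem mem_latticePoints_iff [Finite V] {m : ℕ} {f : V → ℤ} :
    f ∈ P.latticePoints m ↔ (∀ v, 0 ≤ f v ∧ f v ≤ m) ∧ P.IsPartition f := by
  unfold latticePoints dilation
  rw [Set.mem_ofPred_eq]
  split_ifs with h0 h1
  · subst h0
    rw [Set.mem_singleton_iff]
    constructor
    · intro h
      have hf : ∀ v, f v = 0 := fun v => by simpa using congrFun h v
      refine ⟨fun v => by simp [hf], fun x y h => ?_⟩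
      have := h1 x y h
      exact ⟨by simp [hf], fun h' => by omega⟩
    · rintro ⟨h, -⟩
      funext v
      have := h v
      have : f v = 0 := by push_cast at this; omega
      simp [this]
  · subst h0
    simp only [Set.mem_empty_iff_false, false_iff, not_and]
    intro h hf
    refine h1 fun x y hxy => (sign_of_cov hxy).resolve_right fun hs => ?_
    have h2 := (hf x y hxy).2 hs
    have h3 := h x
    have h4 := h y
    push_cast at h3 h4
    omega
  · have hm : (0 : ℝ) < m := by positivity
    rw [isPartition_iff]
    constructor
    · rintro ⟨k, hk, hkf⟩
      have hkf' : ∀ v, (f v : ℝ) = m * k v := fun v => (congrFun hkf v).symm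
      refine ⟨fun v => ⟨?_, ?_⟩, fun x y h => ?_, fun x y h => ?_⟩
      · have : (0 : ℝ) ≤ f v := by
          rw [hkf']; exact mul_nonneg hm.le (hk.1 v).1
        exact_mod_cast this
      · have : (f v : ℝ) ≤ m := by
          rw [hkf']; exact mul_le_of_le_one_right hm.le (hk.1 v).2
        exact_mod_cast this
      · have : (f y : ℝ) ≤ f x := by
          rw [hkf', hkf']; exact mul_le_mul_of_nonneg_left (hk.2.1 x y h) hm.le
        exact_mod_cast this
      · have : (f y : ℝ) < f x := by
          rw [hkf', hkf']; exact mul_lt_mul_of_pos_left (hk.2.2 x y h) hm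
        exact_mod_cast this
    · rintro ⟨hb, hle, hlt⟩
      refine ⟨fun v => f v / m, ⟨fun v => ⟨?_, ?_⟩, fun x y h => ?_, fun x y h => ?_⟩, ?_⟩
      · exact div_nonneg (by exact_mod_cast (hb v).1) hm.le
      · exact (div_le_one hm).2 (by exact_mod_cast (hb v).2)
      · exact div_le_div_of_nonneg_right (by exact_mod_cast hle x y h) hm.le
      · exact div_lt_div_of_pos_right (by exact_mod_cast hlt x y h) hm
      · funext v
        exact mul_div_cancel₀ _ hm.ne'

/-! ### The unique saturation compatible with a lattice point -/

/-- The relation that generates the saturation attached to `f`: the ranks `ρ` differ by one, and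
either `f` drops or `f` is constant and the rank goes up. -/
def Link (ρ f : V → ℤ) (x y : V) : Prop :=
  |ρ y - ρ x| = 1 ∧ (f y < f x ∨ f y = f x ∧ ρ y = ρ x + 1)

theorem link_of_cov [Finite V] {f : V → ℤ} (hP : P.Consistent) (hf : P.IsPartition f) {x y : V}
    (h : P.cov x y) : Link P.rank f x y := by
  have hr := hP.rank_of_cov h
  obtain ⟨h1, h2⟩ := hf x y h
  rcases sign_of_cov h with hs | hs
  · refine ⟨by rw [hr, hs]; simp, ?_⟩
    rcases h1.lt_or_eq with h1 | h1
    · exact Or.inl h1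
    · exact Or.inr ⟨h1, by omega⟩
  · exact ⟨by rw [hr, hs]; simp, Or.inl (h2 hs)⟩

theorem transGen_link_of_lt [Finite V] {f : V → ℤ} (hP : P.Consistent) (hf : P.IsPartition f)
    {x y : V} (h : P.lt x y) : TransGen (Link P.rank f) x y :=
  TransGen.mono (fun _ _ => link_of_cov hP hf) _ _ (lt_iff_transGen_cov.1 h)

/-- Links decrease the pair `(f, -ρ)` lexicographically, so that their transitive closure is
irreflexive. -/
theorem transGen_link_lex {ρ f : V → ℤ} {x y : V} (h : TransGen (Link ρ f) x y) :
    f y < f x ∨ f y = f x ∧ ρ x < ρ y := by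
  induction h with
  | single h => rcases h.2 with h | h <;> omega
  | tail _ h ih => rcases h.2 with h | h <;> omega

/-- A saturation is determined by any one of its partitions. A link makes its two elements
comparable in `Q`, and the opposite direction would contradict the lexicographic decrease along the
order of `Q`. -/
theorem IsSaturation.lt_iff_transGen_link [Finite V] (hQ : P.IsSaturation Q) {f : V → ℤ}
    (hf : Q.IsPartition f) {x y : V} : Q.lt x y ↔ TransGen (Link P.rank f) x y := by
  have hr : Q.rank = P.rank := funext hQ.rank_eq
  constructor
  · rw [← hr]
    exact transGen_link_of_lt hQ.consistent hf
  · have key : ∀ x y, Link P.rank f x y → Q.lt x y := by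
      intro x y h
      have hne : x ≠ y := by
        rintro rfl
        simpa using h.1
      rcases hQ.saturated x y (by rw [hr]; exact h.1) with h' | h'
      · exact (le_iff_eq_or_lt.1 h').resolve_left hne
      · have h1 := transGen_link_lex (transGen_link_of_lt hQ.consistent hf
          ((le_iff_eq_or_lt.1 h').resolve_left hne.symm))
        rw [hr] at h1
        have := h.2
        omega
    intro h
    induction h with
    | single h => exact key _ _ h
    | tail _ h ih => exact lt_trans' ih (key _ _ h)

theorem ext_of_lt_of_rank [Finite V] {Q' : SignedPoset V} (hQ : Q.Consistent)
    (hQ' : Q'.Consistent) (hlt : ∀ x y, Q.lt x y ↔ Q'.lt x y) (hr : Q.rank = Q'.rank) :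
    Q = Q' := by
  refine ext_le_sign (fun x y => by rw [le_iff_eq_or_lt, le_iff_eq_or_lt, hlt]) fun x y => ?_
  have hcov : Q.cov x y ↔ Q'.cov x y := by simp only [cov_iff, hlt]
  by_cases h : Q.cov x y
  · have h1 := hQ.rank_of_cov h
    have h2 := hQ'.rank_of_cov (hcov.1 h)
    rw [hr] at h1
    omega
  · exact (Q.sign_of_not_covBy x y h).trans
      (Q'.sign_of_not_covBy x y fun h' => h (hcov.2 h')).symm

theorem IsSaturation.eq_of_isPartition [Finite V] {Q' : SignedPoset V} (hQ : P.IsSaturation Q)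
    (hQ' : P.IsSaturation Q') {f : V → ℤ} (hf : Q.IsPartition f) (hf' : Q'.IsPartition f) :
    Q = Q' :=
  ext_of_lt_of_rank hQ.consistent hQ'.consistent
    (fun _ _ => (hQ.lt_iff_transGen_link hf).trans (hQ'.lt_iff_transGen_link hf').symm)
    (funext fun x => (hQ.rank_eq x).trans (hQ'.rank_eq x).symm)

theorem IsSaturation.isPartition [Finite V] (hP : P.Consistent) (hQ : P.IsSaturation Q)
    {f : V → ℤ} (hf : Q.IsPartition f) : P.IsPartition f := by
  intro x y h
  have hlex := transGen_link_lex
    ((hQ.lt_iff_transGen_link hf).1 (hQ.extends_order x y (lt_of_cov h)))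
  have hr := hP.rank_of_cov h
  exact ⟨by omega, fun hs => by omega⟩

open Classical in
/-- The poset generated by `Link ρ f`, with the differences of `ρ` as labels. -/
noncomputable def linkPoset (ρ f : V → ℤ) : SignedPoset V :=
  letI ord : PartialOrder V :=
    { le := ReflTransGen (Link ρ f)
      le_refl := fun _ => .refl
      le_trans := fun _ _ _ => .trans
      le_antisymm := fun x y h h' => by
        rcases reflTransGen_iff_eq_or_transGen.1 h with h | h
        · exact h.symm
        rcases reflTransGen_iff_eq_or_transGen.1 h' with h' | h'
        · exact h'
        have h1 := transGen_link_lex h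
        have h2 := transGen_link_lex h'
        omega }
  { order := ord
    sign := fun x y => if x ⋖ y then ρ y - ρ x else 0
    sign_of_covBy := fun x y h => by
      rw [if_pos h]
      rcases ReflTransGen.cases_head (h.le : ReflTransGen (Link ρ f) x y) with rfl | ⟨z, hz, hzy⟩
      · exact (h.ne rfl).elim
      · have hxz : x < z := lt_of_le_of_ne (ReflTransGen.single hz) fun h => by
          subst h
          simpa using hz.1
        have : z = y := by
          by_contra hne
          exact h.2 hxz (lt_of_le_of_ne hzy hne)
        subst this
        exact eq_or_eq_neg_of_abs_eq hz.1
    sign_of_not_covBy := fun x y h => if_neg h }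

theorem linkPoset_lt {ρ f : V → ℤ} {x y : V} :
    (linkPoset ρ f).lt x y ↔ TransGen (Link ρ f) x y := by
  rw [lt_iff]
  change ReflTransGen (Link ρ f) x y ∧ ¬ ReflTransGen (Link ρ f) y x ↔ _
  rw [reflTransGen_iff_eq_or_transGen, reflTransGen_iff_eq_or_transGen]
  constructor
  · rintro ⟨rfl | h, h'⟩
    · exact (h' (Or.inl rfl)).elim
    · exact h
  · refine fun h => ⟨Or.inr h, ?_⟩
    have h1 := transGen_link_lex h
    rintro (rfl | h')
    · omega
    · have h2 := transGen_link_lex h'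
      omega

theorem linkPoset_sign {ρ f : V → ℤ} {x y : V} (h : (linkPoset ρ f).cov x y) :
    (linkPoset ρ f).sign x y = ρ y - ρ x := if_pos h

theorem linkPoset_isPartition {ρ f : V → ℤ} : (linkPoset ρ f).IsPartition f := by
  intro x y h
  have h1 := transGen_link_lex (linkPoset_lt.1 (lt_of_cov h))
  have h2 := linkPoset_sign h
  exact ⟨by omega, fun hs => by omega⟩

/-- The ranks of `linkPoset P.rank f` are those of `P` because the order extends that of `P`, so that
its minimal elements are minimal in `P` and have rank `0`. -/
theorem linkPoset_isSaturation [Finite V] (hP : P.Consistent) {f : V → ℤ}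
    (hf : P.IsPartition f) : P.IsSaturation (linkPoset P.rank f) := by
  have hext : ∀ x y, P.lt x y → (linkPoset P.rank f).lt x y := fun x y h =>
    linkPoset_lt.2 (transGen_link_of_lt hP hf h)
  have key := consistent_and_rank_of_potential (P := linkPoset P.rank f) (ρ := P.rank)
    (fun x hx => hP.rank_of_isMinimal fun z hz => hx z (hext z x hz))
    fun _ _ => linkPoset_sign
  have hlink : ∀ x y, Link P.rank f x y → (linkPoset P.rank f).le x y :=
    fun _ _ h => ReflTransGen.single h
  refine ⟨key.1, fun x y h => ?_, hext, fun x => congrFun key.2 x⟩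
  rw [key.2] at h
  have h' : |P.rank x - P.rank y| = 1 := by rwa [abs_sub_comm]
  rcases lt_trichotomy (f y) (f x) with hxy | hxy | hxy
  · exact Or.inl (hlink x y ⟨h, Or.inl hxy⟩)
  · rcases eq_or_eq_neg_of_abs_eq h with h1 | h1
    · exact Or.inl (hlink x y ⟨h, Or.inr ⟨hxy, by omega⟩⟩)
    · exact Or.inr (hlink y x ⟨h', Or.inr ⟨hxy.symm, by omega⟩⟩)
  · exact Or.inr (hlink y x ⟨h', Or.inl hxy⟩)

/-- The lattice points of `m𝒪(P, ε)` are the disjoint union of those of the `m𝒪(Q, δ)`, over the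
saturations `(Q, δ)`. -/
theorem existsUnique_saturation_of_mem_latticePoints [Finite V] (hP : P.Consistent) {m : ℕ}
    {f : V → ℤ} (hf : f ∈ P.latticePoints m) :
    ∃! Q : SignedPoset V, P.IsSaturation Q ∧ f ∈ Q.latticePoints m := by
  rw [mem_latticePoints_iff] at hf
  refine ⟨linkPoset P.rank f, ⟨linkPoset_isSaturation hP hf.2,
    mem_latticePoints_iff.2 ⟨hf.1, linkPoset_isPartition⟩⟩, fun Q hQ => ?_⟩
  exact hQ.1.eq_of_isPartition (linkPoset_isSaturation hP hf.2)
    (mem_latticePoints_iff.1 hQ.2).2 linkPoset_isPartition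

theorem IsSaturation.latticePoints_subset [Finite V] (hP : P.Consistent) (hQ : P.IsSaturation Q)
    (m : ℕ) : Q.latticePoints m ⊆ P.latticePoints m := fun f hf => by
  rw [mem_latticePoints_iff] at hf ⊢
  exact ⟨hf.1, hQ.isPartition hP hf.2⟩

end SignedPoset

/-! ### Translates of labeled posets -/

namespace SignedPoset

variable {V : Type*} {P Q : SignedPoset V} {g : Equiv.Perm V}

theorem lt_smul_iff {x y : V} : (g • Q).lt x y ↔ Q.lt (g⁻¹ x) (g⁻¹ y) := Iff.rfl

theorem sign_smul {x y : V} : (g • Q).sign x y = Q.sign (g⁻¹ x) (g⁻¹ y) := rfl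

theorem cov_smul_iff {x y : V} : (g • Q).cov x y ↔ Q.cov (g⁻¹ x) (g⁻¹ y) := by
  simp only [cov_iff, lt_smul_iff]
  exact and_congr_right fun _ => (Equiv.forall_congr_right (q := fun z =>
    Q.lt (g⁻¹ x) z → ¬ Q.lt z (g⁻¹ y)) g⁻¹)

theorem smul_eq_of_mem_aut (hg : g ∈ P.aut) : g • P = P := by
  have hi := P.aut.inv_mem hg
  refine ext_le_sign (fun x y => hi.1 x y) fun x y => ?_
  by_cases h : P.cov x y
  · exact hi.2 x y h
  · exact (P.sign_of_not_covBy _ _ fun h' => h ((cov_map_iff hi.1 x y).1 h')).trans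
      (P.sign_of_not_covBy _ _ h).symm

theorem Consistent.smul [Finite V] (hQ : Q.Consistent) (g : Equiv.Perm V) :
    (g • Q).Consistent ∧ (g • Q).rank = fun x => Q.rank (g⁻¹ x) := by
  refine consistent_and_rank_of_potential (fun x hx => hQ.rank_of_isMinimal fun z hz => ?_)
    fun x y h => ?_
  · exact hx (g z) (by rwa [lt_smul_iff, perm_inv_apply])
  · rw [sign_smul, hQ.rank_of_cov (cov_smul_iff.1 h)]
    ring

theorem IsSaturation.smul [Finite V] (hP : P.Consistent) (hg : g ∈ P.aut)
    (hQ : P.IsSaturation Q) : P.IsSaturation (g • Q) := by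
  obtain ⟨h1, h2⟩ := hQ.consistent.smul g
  refine ⟨h1, fun x y h => ?_, fun x y h => ?_, fun x => ?_⟩
  · rw [h2] at h
    exact hQ.saturated _ _ h
  · rw [← smul_eq_of_mem_aut hg] at h
    exact hQ.extends_order _ _ h
  · have h3 := (hP.smul g).2
    rw [smul_eq_of_mem_aut hg] at h3
    rw [h2, h3]
    exact hQ.rank_eq _

theorem isPartition_smul_iff {f : V → ℤ} : (g • Q).IsPartition f ↔ Q.IsPartition (f ∘ g) := by
  simp only [IsPartition, cov_smul_iff, sign_smul]
  constructor
  · intro h x y hxy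
    simpa only [Function.comp_apply, perm_inv_apply] using h (g x) (g y) (by simpa only [perm_inv_apply] using hxy)
  · intro h x y hxy
    simpa only [Function.comp_apply, perm_apply_inv] using h _ _ hxy

theorem mem_latticePoints_smul_iff [Finite V] {m : ℕ} {f : V → ℤ} :
    f ∈ (g • Q).latticePoints m ↔ f ∘ g ∈ Q.latticePoints m := by
  rw [mem_latticePoints_iff, mem_latticePoints_iff, isPartition_smul_iff]
  exact and_congr_left fun _ =>
    (Equiv.forall_congr_right (q := fun v => 0 ≤ f v ∧ f v ≤ (m : ℤ)) g).symm

/-! ### Characters of the lattice points -/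

/-- The lattice points of the `m`-th dilation that are fixed by the permutation `g`. -/
def fixedLatticePoints (P : SignedPoset V) (m : ℕ) (g : Equiv.Perm V) : Set (V → ℤ) :=
  {f | f ∈ P.latticePoints m ∧ f ∘ g = f}

theorem finite_latticePoints [Finite V] (P : SignedPoset V) (m : ℕ) :
    (P.latticePoints m).Finite := Set.toFinite _

theorem finite_fixedLatticePoints [Finite V] (P : SignedPoset V) (m : ℕ) (g : Equiv.Perm V) :
    (P.fixedLatticePoints m g).Finite :=
  (P.finite_latticePoints m).subset fun _ h => h.1

theorem comp_inv_eq_iff {α : Type*} {f : V → α} : f ∘ ⇑g⁻¹ = f ↔ f ∘ g = f := by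
  constructor <;> intro h
  · nth_rewrite 1 [← h]
    funext v
    simp
  · nth_rewrite 1 [← h]
    funext v
    simp

theorem character_latticeRep [Finite V] (P : SignedPoset V) {G : Subgroup (Equiv.Perm V)}
    (hG : G ≤ P.aut) (m : ℕ) (g : G) :
    (P.latticeRep hG m).character g = ((P.fixedLatticePoints m g).ncard : ℂ) := by
  classical
  let _ := Fintype.ofFinite (P.latticePoints m)
  set σ := P.latticeAction m (Subgroup.inclusion hG g)
  have hσ : ∀ f, σ f = f ↔ f.1 ∘ (g : Equiv.Perm V) = f.1 := fun f => by
    rw [Subtype.ext_iff, ← comp_inv_eq_iff]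
    rfl
  unfold Representation.character
  rw [trace_of_basis_perm (MonoidAlgebra.basis (P.latticePoints m) ℂ) σ]
  · rw [Finset.sum_boole, ← Set.ncard_coe_finset]
    congr 1
    refine Set.ncard_congr (fun f _ => f.1) ?_ ?_ ?_
    · intro f hf
      exact ⟨f.2, (hσ f).1 (by simpa using hf)⟩
    · exact fun _ _ _ _ => Subtype.ext
    · intro f hf
      exact ⟨⟨f, hf.1⟩, by simpa using (hσ ⟨f, hf.1⟩).2 hf.2, rfl⟩
  · intro f
    simp [latticeRep, σ]

open Classical in
/-- The map `f ↦ f ∘ x` carries the lattice points of `x • Q` fixed by `g` to those of `Q` fixed by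
`x⁻¹ * g * x`. -/
theorem ncard_fixedLatticePoints_conj [Finite V] (hP : P.Consistent) (hQ : P.IsSaturation Q)
    (m : ℕ) {x : Equiv.Perm V} (hx : x ∈ P.aut) :
    (Q.fixedLatticePoints m (x⁻¹ * g * x)).ncard =
      ((P.finite_fixedLatticePoints m g).toFinset.filter
        (· ∈ (x • Q).latticePoints m)).card := by
  rw [← Set.ncard_coe_finset]
  symm
  refine Set.ncard_congr (fun f _ => f ∘ x) ?_ ?_ ?_
  · intro f hf
    simp only [Finset.coe_filter, Set.Finite.mem_toFinset, Set.mem_ofPred_eq] at hf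
    refine ⟨mem_latticePoints_smul_iff.1 hf.2, ?_⟩
    funext v
    simpa using congrFun hf.1.2 (x v)
  · intro f f' _ _ h
    exact x.surjective.injective_comp_right h
  · intro f hf
    have hmem : f ∘ ⇑x⁻¹ ∈ (x • Q).latticePoints m := by
      rw [mem_latticePoints_smul_iff]
      convert hf.1 using 1
      funext v
      simp
    refine ⟨f ∘ ⇑x⁻¹, ?_, ?_⟩
    · simp only [Finset.coe_filter, Set.Finite.mem_toFinset, Set.mem_ofPred_eq]
      refine ⟨⟨(hQ.smul hP hx).latticePoints_subset hP m hmem, ?_⟩, hmem⟩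
      funext v
      simpa using congrFun hf.2 (x⁻¹ v)
    · funext v
      simp

theorem card_filter_smul_eq {G α : Type*} [Group G] [Fintype G] [MulAction G α] [DecidableEq α]
    {a b : α} (hb : b ∈ MulAction.orbit G a) :
    ((Finset.univ : Finset G).filter fun x => x • a = b).card =
      Nat.card (MulAction.stabilizer G a) := by
  obtain ⟨y, rfl⟩ := hb
  rw [← Set.ncard_coe_finset]
  change _ = Nat.card ((MulAction.stabilizer G a : Subgroup G) : Set G)
  rw [Nat.card_coe_set_eq]
  refine Set.ncard_congr (fun x _ => y⁻¹ * x) ?_ ?_ ?_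
  · intro x hx
    have hx : x • a = y • a := by simpa using hx
    change (y⁻¹ * x) • a = a
    rw [mul_smul, hx, inv_smul_smul]
  · exact fun _ _ _ _ h => mul_left_cancel h
  · intro x hx
    have hx : x • a = a := hx
    exact ⟨y * x, by simp [mul_smul, hx], by simp⟩

open Classical in
/-- The lattice points fixed by `g`, sorted according to the saturation that they belong to. By
uniqueness that saturation is fixed by `g`, and each `G`-orbit representative `Q i` reaches it
through as many group elements as its stabilizer has. -/
theorem ncard_fixedLatticePoints_eq_sum [Finite V] (hP : P.Consistent)
    {G : Subgroup (Equiv.Perm V)} (hG : G ≤ P.aut) [Fintype G] {k : ℕ} {Q : Fin k → SignedPoset V}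
    (hQ : ∀ i, P.IsSaturation (Q i))
    (hrep : ∀ S : SignedPoset V, P.IsSaturation S → ∃! i, S ∈ MulAction.orbit G (Q i))
    (m : ℕ) (g : G) :
    ((P.fixedLatticePoints m g).ncard : ℂ) =
      ∑ i, (Nat.card (MulAction.stabilizer G (Q i)) : ℂ)⁻¹ * ∑ x : G,
        if x⁻¹ * g * x ∈ MulAction.stabilizer G (Q i) then
          (((Q i).fixedLatticePoints m ((x⁻¹ * g * x : G) : Equiv.Perm V)).ncard : ℂ) else 0 := by
  set F := (P.finite_fixedLatticePoints m g).toFinset with hF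
  have hsmul : ∀ i (x : G), P.IsSaturation (x • Q i) := fun i x => (hQ i).smul hP (hG x.2)
  have hterm : ∀ i (x : G), (if x⁻¹ * g * x ∈ MulAction.stabilizer G (Q i) then
      (((Q i).fixedLatticePoints m ((x⁻¹ * g * x : G) : Equiv.Perm V)).ncard : ℂ) else 0) =
      ∑ f ∈ F, if f ∈ (x • Q i).latticePoints m then (1 : ℂ) else 0 := by
    intro i x
    rw [Finset.sum_boole]
    split_ifs with hx
    · congr 1
      exact ncard_fixedLatticePoints_conj hP (hQ i) m (hG x.2)
    -- A common point of `x • Q i` and `g • x • Q i` would force the two saturations to agree.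
    · symm
      rw [Nat.cast_eq_zero, Finset.card_eq_zero, Finset.filter_eq_empty_iff]
      intro f hf hfx
      rw [hF, Set.Finite.mem_toFinset] at hf
      have hgx : f ∈ (g • x • Q i).latticePoints m :=
        mem_latticePoints_smul_iff.2 (by rw [hf.2]; exact hfx)
      have heq : g • x • Q i = x • Q i :=
        (existsUnique_saturation_of_mem_latticePoints hP hf.1).unique
          ⟨by rw [← mul_smul]; exact hsmul i (g * x), hgx⟩ ⟨hsmul i x, hfx⟩
      exact hx (by rw [MulAction.mem_stabilizer_iff, mul_smul, mul_smul, heq, inv_smul_smul])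
  -- After exchanging the sums, it remains to see that each fixed point `f` is counted once.
  simp_rw [hterm]
  rw [Set.ncard_eq_toFinset_card _ (P.finite_fixedLatticePoints m g)]
  simp_rw [Finset.mul_sum (s := (Finset.univ : Finset G)), Finset.mul_sum (s := F)]
  rw [Finset.sum_congr rfl fun i _ => Finset.sum_comm, Finset.sum_comm, ← hF,
    Finset.card_eq_sum_ones, Nat.cast_sum]
  refine Finset.sum_congr rfl fun f hf => ?_
  rw [hF, Set.Finite.mem_toFinset] at hf
  obtain ⟨S, ⟨hS, hfS⟩, huniq⟩ := existsUnique_saturation_of_mem_latticePoints hP hf.1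
  obtain ⟨j, hj, hj'⟩ := hrep S hS
  have hiff : ∀ i (x : G), f ∈ (x • Q i).latticePoints m ↔ x • Q i = S := fun i x =>
    ⟨fun h => huniq _ ⟨hsmul i x, h⟩, fun h => h ▸ hfS⟩
  simp_rw [hiff, ← Finset.mul_sum]
  rw [Finset.sum_eq_single j, Finset.sum_boole, card_filter_smul_eq hj, inv_mul_cancel₀,
    Nat.cast_one]
  · exact Nat.cast_ne_zero.2 Nat.card_pos.ne'
  · intro i _ hij
    rw [Finset.sum_eq_zero, mul_zero]
    exact fun x _ => if_neg fun h => hij (hj' i ⟨x, h⟩)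
  · exact fun h => (h (Finset.mem_univ j)).elim

end SignedPoset

/-! ### The projection formula -/

theorem VirtualCharacterRing.apply_conj {G : Type*} [Group G] (χ : VirtualCharacterRing G)
    (x g : G) : χ.1 (x⁻¹ * g * x) = χ.1 g := by
  obtain ⟨χ, hχ⟩ := χ
  change χ (x⁻¹ * g * x) = χ g
  let S : Subring (G → ℂ) := RingHom.eqLocus
    (Pi.evalRingHom (fun _ : G => ℂ) (x⁻¹ * g * x)) (Pi.evalRingHom (fun _ : G => ℂ) g)
  refine (Subring.closure_le.2 ?_ : VirtualCharacterRing G ≤ S) hχ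
  rintro _ ⟨n, ρ, rfl⟩
  have := ρ.char_conj g x⁻¹
  rwa [inv_inv] at this

/-- The projection formula; it holds because virtual characters are class functions. -/
theorem indVirtual_mul_res {G : Type*} [Group G] [Finite G] (H : Subgroup G)
    (χ : VirtualCharacterRing H) (ψ : VirtualCharacterRing G) :
    indVirtual H (χ * resVirtual H.subtype ψ) = indVirtual H χ * ψ := by
  classical
  refine Subtype.ext (funext fun g => ?_)
  change frobeniusInd H (χ.1 * (resVirtual H.subtype ψ).1) g = frobeniusInd H χ.1 g * ψ.1 g
  simp only [frobeniusInd, AddMonoidHom.coe_mk, ZeroHom.coe_mk]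
  rw [mul_assoc, Finset.sum_mul]
  congr 1
  refine Finset.sum_congr rfl fun x _ => ?_
  split_ifs with hx
  · rw [← VirtualCharacterRing.apply_conj ψ x g]
    rfl
  · rw [zero_mul]

theorem indSeries_mul_res {G : Type*} [Group G] [Finite G] (H : Subgroup G)
    (f : PowerSeries (VirtualCharacterRing H)) (d : PowerSeries (VirtualCharacterRing G)) :
    indSeries H (f * resSeries H.subtype d) = indSeries H f * d := by
  ext1 n
  simp only [indSeries, resSeries, PowerSeries.coeff_mk, PowerSeries.coeff_mul, map_sum,
    PowerSeries.coeff_map, indVirtual_mul_res]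

namespace SignedPoset

variable {V : Type*} {P Q : SignedPoset V}

/-- Both sides are the polynomial of the permutation representation of the stabilizer. -/
theorem resSeries_detIdSub [Finite V] (G : Subgroup (Equiv.Perm V)) (Q : SignedPoset V) :
    resSeries (stabToAut G Q) (detIdSub (permRepExt Q.aut) : PowerSeries _) =
      resSeries (MulAction.stabilizer G Q).subtype
        (detIdSub (permRepExt G) : PowerSeries (VirtualCharacterRing G)) := by
  simp only [resSeries, detIdSub, ← Polynomial.polynomial_map_coe, Polynomial.map_sum,
    Polynomial.map_monomial, map_mul, map_pow, map_neg, map_one, resVirtual_virtualCharacter]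
  rfl

theorem ehrhartSeries_eq_sum [Finite V] (hP : P.Consistent)
    {G : Subgroup (Equiv.Perm V)} (hG : G ≤ P.aut) {k : ℕ} {Q : Fin k → SignedPoset V}
    (hQ : ∀ i, P.IsSaturation (Q i))
    (hrep : ∀ S : SignedPoset V, P.IsSaturation S → ∃! i, S ∈ MulAction.orbit G (Q i)) :
    P.ehrhartSeries hG = ∑ i, indSeries (MulAction.stabilizer G (Q i))
      (resSeries (stabToAut G (Q i)) ((Q i).ehrhartSeries le_rfl)) := by
  classical
  let _ := Fintype.ofFinite G
  ext1 m
  rw [map_sum]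
  simp only [ehrhartSeries, indSeries, resSeries, PowerSeries.coeff_mk, PowerSeries.coeff_map]
  refine Subtype.ext (funext fun g => ?_)
  rw [AddSubmonoidClass.coe_finsetSum, Finset.sum_apply]
  refine (character_latticeRep P hG m g).trans
    ((ncard_fixedLatticePoints_eq_sum hP hG hQ hrep m g).trans ?_)
  refine Finset.sum_congr rfl fun i _ => ?_
  simp only [indVirtual, frobeniusInd, AddMonoidHom.coe_mk, ZeroHom.coe_mk]
  congr 1
  refine Finset.sum_congr (by congr!) fun x _ => ?_
  split_ifs with hx
  · exact (character_latticeRep (Q i) le_rfl m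
      (stabToAut G (Q i) ⟨x⁻¹ * g * x, hx⟩)).symm
  · rfl

end SignedPoset

theorem theorem3 {V : Type*} [Finite V] (P : SignedPoset V) (hP : P.Consistent)
    (G : Subgroup (Equiv.Perm V)) (hG : G ≤ P.aut)
    (k : ℕ) (Q : Fin k → SignedPoset V) (hQ : ∀ i, P.IsSaturation (Q i))
    (hrep : ∀ S : SignedPoset V, P.IsSaturation S → ∃! i, S ∈ MulAction.orbit G (Q i)) :
    P.hStar G hG =
      ∑ i, indSeries (MulAction.stabilizer G (Q i))
        (resSeries (SignedPoset.stabToAut G (Q i)) ((Q i).hStar (Q i).aut le_rfl)) := by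
  unfold SignedPoset.hStar
  rw [SignedPoset.ehrhartSeries_eq_sum hP hG hQ hrep, Finset.sum_mul]
  refine Finset.sum_congr rfl fun i _ => ?_
  rw [← indSeries_mul_res, ← SignedPoset.resSeries_detIdSub]
  exact congrArg _ (map_mul (PowerSeries.map _) _ _).symm
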